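/- Theorem 3.1. For a graph $G=([n],E)$ (undirected, simple) and $U\subseteq[n]$, an independent-set query on $U$ returns whether $U$ is an independent set of $G$, i.e. whether no edge of $G$ has both endpoints in $U$. A randomized algorithm with access to the independent set oracle of $G$ is a randomized decision tree: at each step it either asks an independent-set query on some $U\subseteq[n]$, or flips a (possibly biased) coin, or stops with an output; every step may depend on all earlier answers and coin flips, and its complexity is the number of queries it makes. There are a randomized algorithm $\texttt{Estimate-Edges}(\varepsilon,n,G)$, constants $C,c$ and a function $\delta:\mathbb N\to\mathbb R$ with $\delta(n)\to 0$ as $n\to\infty$ such that the following holds for every $\varepsilon\in(0,1)$, every positive integer $n$ and every graph $G=([n],E)$ with $m=|E|\ge 1$. The algorithm takes as input $\varepsilon$, $n$ and access to the independent set oracle of $G$ (neither $G$ nor $m$ is given to it otherwise), and with probability at least $1-\delta(n)$ it both makes at most $$\frac{n}{\sqrt m}\cdot C\,(\log n)^{c}\,(1/\varepsilon)^{c}$$ independent-set queries and outputs a real number $\widetilde m$ satisfying $(1-\varepsilon)m\le\widetilde m\le(1+\varepsilon)m$. -/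

import Mathlib

/-- A randomized query algorithm on the vertex set `Fin n`, with output in `α`, as a randomized
decision tree: at each point of its execution it stops with an output, or asks the oracle about a
set `U` of vertices and continues according to the answer, or flips a coin (fair or
biased, with distribution `p`) and continues according to the outcome.  Such an algorithm can access the graph
only through its queries, and each of its executions is finite. -/
inductive QueryAlg (n : ℕ) (α : Type) : Type
  | output (x : α) : QueryAlg n α
  | query (U : Finset (Fin n)) (next : Bool → QueryAlg n α) : QueryAlg n α
  | flip (p : PMF Bool) (next : Bool → QueryAlg n α) : QueryAlg n α

/-- The joint law of the output and of the number of queries made, when the queries of the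
algorithm are answered by the oracle `O` and its coin flips are independent. -/
noncomputable def QueryAlg.run {n : ℕ} {α : Type} (O : Finset (Fin n) → Bool) :
    QueryAlg n α → PMF (α × ℕ)
  | .output x => PMF.pure (x, 0)
  | .query U next => (QueryAlg.run O (next (O U))).map fun r => (r.1, r.2 + 1)
  | .flip p next => p.bind fun b => QueryAlg.run O (next b)

open Classical in
/-- The independent set oracle of `G`: it answers `true` on `U` iff `U` is independent in `G`. -/
noncomputable def indepSetOracle {n : ℕ} (G : SimpleGraph (Fin n)) (U : Finset (Fin n)) : Bool :=
  decide (G.IsIndepSet (U : Set (Fin n)))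

/-!
Put each vertex into a random set `S` independently with probability `p`. The expected number of
edges inside `S` is `m p ^ 2`. Disjoint edges are independent and each edge meets at most
`2 n` others, so for `m p ^ 2 ≤ 1` the variance is `O(n p)`, and already `n p / ε ^ 2` independent
samples, up to logarithms, determine `m` up to an error of `ε / p ^ 2`. For `p` of the order of
`1 / √m` this is a relative error of `ε` from `n / √m` samples, with no condition on the degrees.
Since `m` is unknown, `p = 2 ^ t / n` is doubled until the samples contain `1 / 8` edge on average.
The stages before that are geometrically cheaper.

It remains to count the edges inside `S` with few queries (`QueryAlg.returns_countWithin`). Halving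
splits `S` into independent pieces; the nonindependent parts that occur at one level are disjoint
and contain an edge each, hence their number is bounded by the size of a matching in `S`. A
pair of independent pieces is then searched for its edges by bisection, at logarithmic cost per
edge. The cost is thus governed by the number of edges in `S` and by the square of a matching
number. The latter is at most the number of pairs of equal or disjoint edges in `S`
(`SimpleGraph.disjointPairs`), whose expectation is at most a constant if `m p ^ 2 ≤ 1`, whereas the
square of the number of edges may have an expectation as large as `n p`.

All probabilities are handled through the expectation functional `QueryAlg.expect`. The analysis of
one stage consists of `QueryAlg.expect_sampleCount_sq_le` and
`QueryAlg.expect_sampleCount_cost_le`; `QueryAlg.expect_firstStop_le` combines the stages by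
Chebyshev's inequality, a union bound and Markov's inequality.
-/

namespace QueryAlg

/-! ### Expectations over the leaves of a randomized decision tree -/

variable {n : ℕ} {α β : Type} {O : Finset (Fin n) → Bool}

/-- Sequential composition: run `A`, then continue with `k x`, where `x` is the output of `A`. -/
def bind : QueryAlg n α → (α → QueryAlg n β) → QueryAlg n β
  | output x, k => k x
  | query U next, k => query U fun b => (next b).bind k
  | flip p next, k => flip p fun b => (next b).bind k

/-- The expectation of `f (output, number of queries)` when the oracle is `O`. Since the tree
branches finitely it is defined by recursion, for every real `f`, with no summability condition. -/
noncomputable def expect (O : Finset (Fin n) → Bool) : QueryAlg n α → (α × ℕ → ℝ) → ℝ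
  | output x, f => f (x, 0)
  | query U next, f => expect O (next (O U)) fun r => f (r.1, r.2 + 1)
  | flip p next, f =>
      (p true).toReal * expect O (next true) f + (p false).toReal * expect O (next false) f

lemma toReal_true_add_toReal_false (p : PMF Bool) :
    (p true).toReal + (p false).toReal = 1 := by
  rw [← ENNReal.toReal_add (p.apply_ne_top _) (p.apply_ne_top _)]
  have h := p.tsum_coe
  rw [tsum_bool, add_comm] at h
  rw [h, ENNReal.toReal_one]

lemma expect_mono (A : QueryAlg n α) {f g : α × ℕ → ℝ} (h : ∀ r, f r ≤ g r) :
    expect O A f ≤ expect O A g := by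
  induction A generalizing f g with
  | output x => exact h _
  | query U next ih => exact ih _ fun r => h _
  | flip p next ih =>
    exact add_le_add (mul_le_mul_of_nonneg_left (ih _ h) ENNReal.toReal_nonneg)
      (mul_le_mul_of_nonneg_left (ih _ h) ENNReal.toReal_nonneg)

lemma expect_add (A : QueryAlg n α) (f g : α × ℕ → ℝ) :
    expect O A (fun r => f r + g r) = expect O A f + expect O A g := by
  induction A generalizing f g with
  | output x => rfl
  | query U next ih => exact ih _ _ _
  | flip p next ih => simp only [expect, ih]; ring

lemma expect_mul_left (A : QueryAlg n α) (c : ℝ) (f : α × ℕ → ℝ) :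
    expect O A (fun r => c * f r) = c * expect O A f := by
  induction A generalizing f with
  | output x => rfl
  | query U next ih => exact ih _ _
  | flip p next ih => simp only [expect, ih]; ring

@[simp]
lemma expect_const (A : QueryAlg n α) (c : ℝ) : expect O A (fun _ => c) = c := by
  induction A with
  | output x => rfl
  | query U next ih => exact ih _
  | flip p next ih => rw [expect, ih, ih, ← add_mul, toReal_true_add_toReal_false, one_mul]

lemma expect_sum {ι : Type*} (A : QueryAlg n α) (s : Finset ι) (f : ι → α × ℕ → ℝ) :
    expect O A (fun r => ∑ i ∈ s, f i r) = ∑ i ∈ s, expect O A (f i) := by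
  classical
  induction s using Finset.induction_on with
  | empty => simp
  | insert i s hi ih => simp only [Finset.sum_insert hi, expect_add, ih]

lemma expect_bind (A : QueryAlg n α) (k : α → QueryAlg n β) (f : β × ℕ → ℝ) :
    expect O (A.bind k) f =
      expect O A fun r => expect O (k r.1) fun s => f (s.1, r.2 + s.2) := by
  induction A generalizing f with
  | output x => simp [bind, expect]
  | query U next ih => simp only [bind, expect, ih]; simp only [add_right_comm, add_assoc]
  | flip p next ih => simp only [bind, expect, ih]

/-- The law `QueryAlg.run` and the recursive expectation agree on indicator functions. -/
lemma toOuterMeasure_run (A : QueryAlg n α) (s : Set (α × ℕ)) :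
    (A.run O).toOuterMeasure s = ENNReal.ofReal (expect O A (s.indicator fun _ => 1)) := by
  classical
  induction A generalizing s with
  | output x =>
    by_cases h : (x, 0) ∈ s <;> simp [run, expect, h]
  | query U next ih =>
    rw [run, PMF.toOuterMeasure_map_apply, ih]
    rfl
  | flip p next ih =>
    have hnn : ∀ b, 0 ≤ expect O (next b) (s.indicator fun _ => (1 : ℝ)) := fun b =>
      (expect_const (O := O) (next b) 0).symm.le.trans
        (expect_mono _ fun r => Set.indicator_nonneg (fun _ _ => zero_le_one) r)
    rw [run, PMF.toOuterMeasure_bind_apply, tsum_bool, ih, ih, expect,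
      ENNReal.ofReal_add (mul_nonneg ENNReal.toReal_nonneg (hnn _))
        (mul_nonneg ENNReal.toReal_nonneg (hnn _)),
      ENNReal.ofReal_mul ENNReal.toReal_nonneg, ENNReal.ofReal_mul ENNReal.toReal_nonneg,
      ENNReal.ofReal_toReal (p.apply_ne_top _), ENNReal.ofReal_toReal (p.apply_ne_top _), add_comm]

/-! ### Deterministic subroutines -/

/-- Against the oracle `O`, the tree `A` surely outputs `v` after exactly `c` queries. -/
def Returns (O : Finset (Fin n) → Bool) (A : QueryAlg n α) (v : α) (c : ℕ) : Prop :=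
  ∀ f, expect O A f = f (v, c)

lemma returns_output (x : α) : Returns O (output x) x 0 := fun _ => rfl

lemma Returns.bind {A : QueryAlg n α} {k : α → QueryAlg n β} {v : α} {w : β} {c d : ℕ}
    (hA : Returns O A v c) (hk : Returns O (k v) w d) : Returns O (A.bind k) w (c + d) :=
  fun f => by rw [expect_bind, hA, hk]

lemma Returns.query {U : Finset (Fin n)} {next : Bool → QueryAlg n α} {v : α} {c : ℕ}
    (h : Returns O (next (O U)) v c) : Returns O (QueryAlg.query U next) v (c + 1) :=
  fun _ => h _

/-- Runs `k x` for the entries `x` of a list one after another and adds up the outputs. -/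
def sumOver (k : α → QueryAlg n ℕ) : List α → QueryAlg n ℕ
  | [] => output 0
  | x :: l => (k x).bind fun a => (sumOver k l).bind fun b => output (a + b)

lemma returns_sumOver {k : α → QueryAlg n ℕ} {v c : α → ℕ} (l : List α)
    (h : ∀ x ∈ l, Returns O (k x) (v x) (c x)) :
    Returns O (sumOver k l) (l.map v).sum (l.map c).sum := by
  induction l with
  | nil => exact returns_output _
  | cons x l ih =>
    simp only [List.mem_cons, forall_eq_or_imp] at h
    rw [List.map_cons, List.map_cons, List.sum_cons, List.sum_cons]
    have hl : Returns O ((sumOver k l).bind fun b => output (v x + b))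
        (v x + (l.map v).sum) ((l.map c).sum + 0) := (ih h.2).bind (returns_output _)
    exact h.1.bind hl

end QueryAlg

namespace QueryAlg

/-! ### Finding the edges inside a set of vertices -/

/-- A subset of `A` which, if `A` has at most `2 ^ (d + 1)` elements, splits it into two parts of at
most `2 ^ d` elements each. -/
noncomputable def half {n : ℕ} (d : ℕ) (A : Finset (Fin n)) : Finset (Fin n) :=
  if h : ∃ B ⊆ A, B.card ≤ 2 ^ d ∧ (A \ B).card ≤ 2 ^ d then h.choose else ∅

lemma half_spec {n d : ℕ} {A : Finset (Fin n)} (hA : A.card ≤ 2 ^ (d + 1)) :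
    half d A ⊆ A ∧ (half d A).card ≤ 2 ^ d ∧ (A \ half d A).card ≤ 2 ^ d := by
  have h : ∃ B ⊆ A, B.card ≤ 2 ^ d ∧ (A \ B).card ≤ 2 ^ d := by
    obtain ⟨B, hBA, hB⟩ := Finset.exists_subset_card_eq (s := A) (min_le_left A.card (2 ^ d))
    refine ⟨B, hBA, hB ▸ min_le_right _ _, ?_⟩
    rw [Finset.card_sdiff_of_subset hBA]
    rw [pow_succ] at hA
    omega
  rw [half, dif_pos h]
  exact h.choose_spec

/-- Finds the vertices of `A` that have a neighbour in `B` by halving `A`, `d` times at most; it is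
meant for independent sets `A` and `B` with `A.card ≤ 2 ^ d`. -/
noncomputable def findNeighbors {n : ℕ} (B : Finset (Fin n)) :
    ℕ → Finset (Fin n) → QueryAlg n (Finset (Fin n))
  | 0, A => query (B ∪ A) fun b => if b then output ∅ else output A
  | d + 1, A => query (B ∪ A) fun b =>
      if b then output ∅
      else (findNeighbors B d (half d A)).bind fun X =>
        (findNeighbors B d (A \ half d A)).bind fun Y => output (X ∪ Y)

/-- Counts the edges between the independent sets `P` and `Q`. -/
noncomputable def countBetween {n : ℕ} (d : ℕ) (P Q : Finset (Fin n)) : QueryAlg n ℕ :=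
  (findNeighbors P d Q).bind fun F =>
    sumOver (fun v => (findNeighbors {v} d P).bind fun X => output X.card) F.toList

/-- Splits `A` into independent sets by halving, as long as the parts are not independent. -/
noncomputable def independentPieces {n : ℕ} :
    ℕ → Finset (Fin n) → QueryAlg n (List (Finset (Fin n)))
  | 0, A => query A fun _ => output [A]
  | d + 1, A => query A fun b =>
      if b then output [A]
      else (independentPieces d (half d A)).bind fun l =>
        (independentPieces d (A \ half d A)).bind fun l' => output (l ++ l')

/-- Counts the ordered pairs of adjacent vertices in `S`. -/
noncomputable def countWithin {n : ℕ} (d : ℕ) (S : Finset (Fin n)) : QueryAlg n ℕ :=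
  (independentPieces d S).bind fun l => sumOver (fun P => sumOver (fun Q => countBetween d P Q) l) l

end QueryAlg

namespace SimpleGraph

variable {n : ℕ} (G : SimpleGraph (Fin n)) [DecidableRel G.Adj]

/-- The number of pairs `(u, v)` of adjacent vertices with `u ∈ A` and `v ∈ B`. In
`G.adjPairs A A` every edge inside `A` is counted twice. -/
def adjPairs (A B : Finset (Fin n)) : ℕ := ∑ u ∈ A, ∑ v ∈ B, if G.Adj u v then 1 else 0

/-- The pairs `(u, v)` of adjacent vertices in `A`. -/
def dartsIn (A : Finset (Fin n)) : Finset ((Fin n) × Fin n) :=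
  (A ×ˢ A).filter fun x => G.Adj x.1 x.2

/-- The two endpoints of a pair of vertices. -/
def ends (x : Fin n × Fin n) : Finset (Fin n) := {x.1, x.2}

/-- The number of ordered pairs of oriented edges in `A` that are equal or have no vertex in
common. It is at least the square of the size of any matching in `A`. In a random set its
expectation is small, in contrast to that of the square of the number of edges. -/
def disjointPairs (A : Finset (Fin n)) : ℕ :=
  ((G.dartsIn A ×ˢ G.dartsIn A).filter fun z => z.1 = z.2 ∨ Disjoint (ends z.1) (ends z.2)).card

lemma mem_dartsIn {A : Finset (Fin n)} {x : Fin n × Fin n} :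
    x ∈ G.dartsIn A ↔ ends x ⊆ A ∧ G.Adj x.1 x.2 := by
  simp [dartsIn, ends, Finset.insert_subset_iff]

lemma card_dartsIn (A : Finset (Fin n)) : (G.dartsIn A).card = G.adjPairs A A := by
  rw [dartsIn, Finset.card_filter, Finset.sum_product, adjPairs]

lemma adjPairs_self_le_disjointPairs (A : Finset (Fin n)) :
    G.adjPairs A A ≤ G.disjointPairs A := by
  rw [← card_dartsIn]
  refine Finset.card_le_card_of_injOn (fun x => (x, x)) (fun x hx => ?_) (fun x _ y _ h => ?_)
  · simpa using hx
  · exact (Prod.ext_iff.1 h).1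

lemma disjointPairs_le_sq (A : Finset (Fin n)) : G.disjointPairs A ≤ (G.dartsIn A).card ^ 2 := by
  rw [sq, ← Finset.card_product]
  exact Finset.card_filter_le _ _

lemma one_le_disjointPairs {A : Finset (Fin n)} (h : ¬ G.IsIndepSet (A : Set (Fin n))) :
    1 ≤ G.disjointPairs A := by
  simp only [SimpleGraph.isIndepSet_iff, Set.Pairwise, not_forall, not_not] at h
  obtain ⟨u, hu, v, hv, -, huv⟩ := h
  refine Finset.card_pos.2 ⟨((u, v), (u, v)), ?_⟩
  simp_all [mem_dartsIn, ends, Finset.insert_subset_iff]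

lemma disjointPairs_add_le {A B C : Finset (Fin n)} (hA : A ⊆ C) (hB : B ⊆ C)
    (h : Disjoint A B) :
    G.disjointPairs A + G.disjointPairs B + 2 * ((G.dartsIn A).card * (G.dartsIn B).card) ≤
      G.disjointPairs C := by
  classical
  have hne : ∀ x ∈ G.dartsIn A, ∀ y ∈ G.dartsIn B, Disjoint (ends x) (ends y) := fun x hx y hy =>
    Finset.disjoint_of_subset_left (G.mem_dartsIn.1 hx).1
      (Finset.disjoint_of_subset_right (G.mem_dartsIn.1 hy).1 h)
  have hAB : Disjoint (G.dartsIn A) (G.dartsIn B) := by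
    refine Finset.disjoint_left.2 fun x hx hx' => ?_
    have := hne x hx x hx'
    simp [ends] at this
  have hAC : G.dartsIn A ⊆ G.dartsIn C := fun x hx => by
    rw [mem_dartsIn] at hx ⊢; exact ⟨hx.1.trans hA, hx.2⟩
  have hBC : G.dartsIn B ⊆ G.dartsIn C := fun x hx => by
    rw [mem_dartsIn] at hx ⊢; exact ⟨hx.1.trans hB, hx.2⟩
  have key : ∀ X Y : Finset (Fin n × Fin n), X ⊆ G.dartsIn C → Y ⊆ G.dartsIn C →
      ∀ z ∈ (X ×ˢ Y).filter (fun z => z.1 = z.2 ∨ Disjoint (ends z.1) (ends z.2)),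
      z ∈ (G.dartsIn C ×ˢ G.dartsIn C).filter
        fun z => z.1 = z.2 ∨ Disjoint (ends z.1) (ends z.2) := by
    intro X Y hX hY z hz
    simp only [Finset.mem_filter, Finset.mem_product] at hz ⊢
    exact ⟨⟨hX hz.1.1, hY hz.1.2⟩, hz.2⟩
  have cross : (G.dartsIn A ×ˢ G.dartsIn B).filter
      (fun z => z.1 = z.2 ∨ Disjoint (ends z.1) (ends z.2)) = G.dartsIn A ×ˢ G.dartsIn B :=
    Finset.filter_true_of_mem fun z hz => by
      rw [Finset.mem_product] at hz; exact Or.inr (hne _ hz.1 _ hz.2)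
  have cross' : (G.dartsIn B ×ˢ G.dartsIn A).filter
      (fun z => z.1 = z.2 ∨ Disjoint (ends z.1) (ends z.2)) = G.dartsIn B ×ˢ G.dartsIn A :=
    Finset.filter_true_of_mem fun z hz => by
      rw [Finset.mem_product] at hz; exact Or.inr (hne _ hz.2 _ hz.1).symm
  have hsub : ((((G.dartsIn A ×ˢ G.dartsIn A).filter
      (fun z => z.1 = z.2 ∨ Disjoint (ends z.1) (ends z.2)) ∪
      (G.dartsIn B ×ˢ G.dartsIn B).filter
      (fun z => z.1 = z.2 ∨ Disjoint (ends z.1) (ends z.2))) ∪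
      G.dartsIn A ×ˢ G.dartsIn B) ∪ G.dartsIn B ×ˢ G.dartsIn A) ⊆
      (G.dartsIn C ×ˢ G.dartsIn C).filter
        fun z => z.1 = z.2 ∨ Disjoint (ends z.1) (ends z.2) := by
    rw [← cross, ← cross']
    intro z hz
    simp only [Finset.mem_union] at hz
    rcases hz with ((hz | hz) | hz) | hz
    · exact key _ _ hAC hAC z hz
    · exact key _ _ hBC hBC z hz
    · exact key _ _ hAC hBC z hz
    · exact key _ _ hBC hAC z hz
  refine le_trans (le_of_eq ?_) (Finset.card_le_card hsub)
  rw [Finset.disjoint_left] at hAB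
  rw [Finset.card_union_of_disjoint, Finset.card_union_of_disjoint, Finset.card_union_of_disjoint,
    Finset.card_product, Finset.card_product, disjointPairs, disjointPairs]
  · ring
  all_goals
    refine Finset.disjoint_left.2 fun z hz hz' => ?_
    simp only [Finset.mem_union, Finset.mem_filter, Finset.mem_product] at hz hz'
    have h1 := @hAB z.1
    have h2 := @hAB z.2
    tauto

/-- Superadditivity over disjoint sets is what bounds the number of pieces and of
queries of the halving procedure, level by level. -/
lemma sqrt_disjointPairs_add_le {A B C : Finset (Fin n)} (hA : A ⊆ C) (hB : B ⊆ C)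
    (h : Disjoint A B) :
    √(G.disjointPairs A : ℝ) + √(G.disjointPairs B : ℝ) ≤ √(G.disjointPairs C : ℝ) := by
  refine Real.le_sqrt_of_sq_le ?_
  have hle : ∀ X, √(G.disjointPairs X : ℝ) ≤ (G.dartsIn X).card := fun X =>
    Real.sqrt_le_iff.2 ⟨Nat.cast_nonneg _, mod_cast G.disjointPairs_le_sq X⟩
  have hC : (G.disjointPairs A : ℝ) + G.disjointPairs B +
      2 * ((G.dartsIn A).card * (G.dartsIn B).card) ≤ G.disjointPairs C :=
    mod_cast G.disjointPairs_add_le hA hB h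
  have := mul_le_mul (hle A) (hle B) (Real.sqrt_nonneg _) (Nat.cast_nonneg _)
  rw [add_sq, Real.sq_sqrt (Nat.cast_nonneg _), Real.sq_sqrt (Nat.cast_nonneg _)]
  linarith

end SimpleGraph

namespace QueryAlg

/-! ### Correctness and query complexity of the edge search -/

variable {n : ℕ} (G : SimpleGraph (Fin n))

lemma indepSetOracle_eq_true {U : Finset (Fin n)} :
    indepSetOracle G U = true ↔ G.IsIndepSet (U : Set (Fin n)) := by
  simp [indepSetOracle]

lemma isIndepSet_of_card_le_one {A : Finset (Fin n)} (hA : A.card ≤ 1) :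
    G.IsIndepSet (A : Set (Fin n)) := by
  rw [SimpleGraph.isIndepSet_iff]
  intro u hu v hv huv
  exact absurd (Finset.card_le_one.1 hA u hu v hv) huv

lemma isIndepSet_mono {A B : Finset (Fin n)} (h : A ⊆ B) (hB : G.IsIndepSet (B : Set (Fin n))) :
    G.IsIndepSet (A : Set (Fin n)) :=
  Set.Pairwise.mono (Finset.coe_subset.2 h) hB

variable [DecidableRel G.Adj]

lemma isIndepSet_union_iff {A B : Finset (Fin n)} (hA : G.IsIndepSet (A : Set (Fin n)))
    (hB : G.IsIndepSet (B : Set (Fin n))) :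
    G.IsIndepSet ((B ∪ A : Finset (Fin n)) : Set (Fin n)) ↔
      A.filter (fun v => ∃ u ∈ B, G.Adj v u) = ∅ := by
  simp only [SimpleGraph.isIndepSet_iff, Set.Pairwise, Finset.coe_union, Set.mem_union,
    Finset.mem_coe, Finset.filter_eq_empty_iff, not_exists, not_and] at *
  constructor
  · exact fun h v hv u hu huv => h (Or.inr hv) (Or.inl hu) huv.ne huv
  · rintro h u (hu | hu) v (hv | hv) huv
    · exact hB hu hv huv
    · exact fun h' => h hv u hu h'.symm
    · exact h hu v hv
    · exact hA hu hv huv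

/-- Each level of the halving has at most as many nonindependent queries as there are vertices to be
found, and each of them leads to two further queries. -/
lemma returns_findNeighbors {B : Finset (Fin n)} (hB : G.IsIndepSet (B : Set (Fin n))) (d : ℕ)
    {A : Finset (Fin n)} (hA : G.IsIndepSet (A : Set (Fin n))) (hd : A.card ≤ 2 ^ d) :
    ∃ c ≤ 1 + 2 * d * (A.filter fun v => ∃ u ∈ B, G.Adj v u).card,
      Returns (indepSetOracle G) (findNeighbors B d A)
        (A.filter fun v => ∃ u ∈ B, G.Adj v u) c := by
  induction d generalizing A with
  | zero =>
    refine ⟨0 + 1, by omega, Returns.query ?_⟩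
    by_cases h : indepSetOracle G (B ∪ A) = true
    · rw [if_pos h, (isIndepSet_union_iff G hA hB).1 ((indepSetOracle_eq_true G).1 h)]
      exact returns_output _
    · have hne : (A.filter fun v => ∃ u ∈ B, G.Adj v u).Nonempty := by
        rw [indepSetOracle_eq_true, isIndepSet_union_iff G hA hB] at h
        exact Finset.nonempty_iff_ne_empty.2 h
      have : A.filter (fun v => ∃ u ∈ B, G.Adj v u) = A :=
        Finset.eq_of_subset_of_card_le (Finset.filter_subset _ _)
          (hd.trans (by simpa using hne.card_pos))
      rw [if_neg h, this]
      exact returns_output _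
  | succ d ih =>
    by_cases h : indepSetOracle G (B ∪ A) = true
    · refine ⟨0 + 1, by omega, Returns.query ?_⟩
      rw [if_pos h, (isIndepSet_union_iff G hA hB).1 ((indepSetOracle_eq_true G).1 h)]
      exact returns_output _
    · have hne : (A.filter fun v => ∃ u ∈ B, G.Adj v u).Nonempty := by
        rw [indepSetOracle_eq_true, isIndepSet_union_iff G hA hB] at h
        exact Finset.nonempty_iff_ne_empty.2 h
      obtain ⟨hs, h1, h2⟩ := half_spec hd
      obtain ⟨c1, hc1, r1⟩ := ih (isIndepSet_mono G hs hA) h1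
      obtain ⟨c2, hc2, r2⟩ := ih (isIndepSet_mono G Finset.sdiff_subset hA) h2
      have hunion : A.filter (fun v => ∃ u ∈ B, G.Adj v u) =
          (half d A).filter (fun v => ∃ u ∈ B, G.Adj v u) ∪
            (A \ half d A).filter (fun v => ∃ u ∈ B, G.Adj v u) := by
        rw [← Finset.filter_union, Finset.union_sdiff_of_subset hs]
      have hcard : (A.filter fun v => ∃ u ∈ B, G.Adj v u).card =
          ((half d A).filter fun v => ∃ u ∈ B, G.Adj v u).card +
            ((A \ half d A).filter fun v => ∃ u ∈ B, G.Adj v u).card := by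
        rw [hunion, Finset.card_union_of_disjoint]
        exact Finset.disjoint_filter_filter Finset.disjoint_sdiff
      refine ⟨c1 + (c2 + 0) + 1, ?_, Returns.query ?_⟩
      · have := hne.card_pos
        rw [hcard] at this ⊢
        nlinarith
      · rw [if_neg h]
        have r2' : Returns (indepSetOracle G) ((findNeighbors B d (A \ half d A)).bind fun Y =>
            output ((half d A).filter (fun v => ∃ u ∈ B, G.Adj v u) ∪ Y))
            (A.filter fun v => ∃ u ∈ B, G.Adj v u) (c2 + 0) := by
          rw [hunion]
          exact r2.bind (returns_output _)
        exact r1.bind r2'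

lemma sum_adj_eq_card (u : Fin n) (P : Finset (Fin n)) :
    (∑ v ∈ P, if G.Adj u v then 1 else 0) =
      (P.filter fun v => ∃ w ∈ ({u} : Finset (Fin n)), G.Adj v w).card := by
  rw [Finset.sum_boole, Nat.cast_id]
  simp only [Finset.mem_singleton, exists_eq_left, G.adj_comm u]

lemma returns_countBetween {d : ℕ} {P Q : Finset (Fin n)} (hP : G.IsIndepSet (P : Set (Fin n)))
    (hQ : G.IsIndepSet (Q : Set (Fin n))) (hPd : P.card ≤ 2 ^ d) (hQd : Q.card ≤ 2 ^ d) :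
    ∃ c ≤ 1 + (4 * d + 1) * G.adjPairs Q P,
      Returns (indepSetOracle G) (countBetween d P Q) (G.adjPairs Q P) c := by
  obtain ⟨c₀, hc₀, r₀⟩ := returns_findNeighbors G hP d hQ hQd
  set F := Q.filter fun v => ∃ u ∈ P, G.Adj v u with hF
  have hex : ∀ v, ∃ c ≤ 1 + 2 * d * (∑ w ∈ P, if G.Adj v w then 1 else 0),
      Returns (indepSetOracle G) ((findNeighbors {v} d P).bind fun X => output X.card)
        (∑ w ∈ P, if G.Adj v w then 1 else 0) c := fun v => by
    obtain ⟨c, hc, r⟩ := returns_findNeighbors G (B := {v})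
      (isIndepSet_of_card_le_one G (by simp)) d hP hPd
    rw [sum_adj_eq_card]
    exact ⟨c + 0, hc, r.bind (returns_output _)⟩
  choose c hc r using hex
  have hval : (F.toList.map fun v => ∑ w ∈ P, if G.Adj v w then 1 else 0).sum =
      G.adjPairs Q P := by
    rw [Finset.sum_map_toList, SimpleGraph.adjPairs, hF, Finset.sum_filter_of_ne]
    intro v _ hv
    obtain ⟨w, hw, h⟩ := Finset.exists_ne_zero_of_sum_ne_zero hv
    exact ⟨w, hw, by simpa using h⟩
  have hFle : F.card ≤ G.adjPairs Q P := by
    rw [← hval, Finset.sum_map_toList, Finset.card_eq_sum_ones]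
    refine Finset.sum_le_sum fun v hv => ?_
    obtain ⟨w, hw, h⟩ := (Finset.mem_filter.1 hv).2
    exact (if_pos h).symm.le.trans
      (Finset.single_le_sum (f := fun w => if G.Adj v w then 1 else 0) (fun _ _ => Nat.zero_le _) hw)
  refine ⟨c₀ + (F.toList.map c).sum, ?_, r₀.bind ?_⟩
  · have hsum : (F.toList.map c).sum ≤ F.card + 2 * d * G.adjPairs Q P := by
      rw [← hval, Finset.sum_map_toList, Finset.sum_map_toList, Finset.card_eq_sum_ones,
        Finset.mul_sum, ← Finset.sum_add_distrib]
      exact Finset.sum_le_sum fun v _ => hc v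
    have := Nat.mul_le_mul_left (2 * d) hFle
    linarith
  · rw [← hval]
    exact returns_sumOver _ fun v _ => r v

/-- The output of `independentPieces` partitions `A` into independent sets; that it is a partition is
expressed through sums over `A`. -/
lemma returns_independentPieces (d : ℕ) {A : Finset (Fin n)} (hd : A.card ≤ 2 ^ d) :
    ∃ (l : List (Finset (Fin n))) (c : ℕ),
      (∀ P ∈ l, P ⊆ A ∧ G.IsIndepSet (P : Set (Fin n))) ∧
      (∀ f : Fin n → ℕ, (l.map fun P => ∑ v ∈ P, f v).sum = ∑ v ∈ A, f v) ∧
      (l.length : ℝ) ≤ 1 + d * √(G.disjointPairs A : ℝ) ∧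
      (c : ℝ) ≤ 1 + 2 * d * √(G.disjointPairs A : ℝ) ∧
      Returns (indepSetOracle G) (independentPieces d A) l c := by
  induction d generalizing A with
  | zero =>
    refine ⟨[A], 0 + 1, ?_, by simp, by simp, by simp, Returns.query (returns_output _)⟩
    simpa using isIndepSet_of_card_le_one G (by simpa using hd)
  | succ d ih =>
    have hsq := Real.sqrt_nonneg (G.disjointPairs A : ℝ)
    by_cases h : indepSetOracle G A = true
    · refine ⟨[A], 0 + 1, ?_, by simp, ?_, ?_, Returns.query ?_⟩
      · simpa using (indepSetOracle_eq_true G).1 h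
      · simp only [List.length_singleton, Nat.cast_one, le_add_iff_nonneg_right]
        positivity
      · simp only [zero_add, Nat.cast_one, le_add_iff_nonneg_right]
        positivity
      · rw [if_pos h]
        exact returns_output _
    · obtain ⟨hs, h1, h2⟩ := half_spec hd
      obtain ⟨l1, c1, hp1, hs1, hl1, hc1, r1⟩ := ih h1
      obtain ⟨l2, c2, hp2, hs2, hl2, hc2, r2⟩ := ih h2
      have hone : 1 ≤ √(G.disjointPairs A : ℝ) := by
        rw [Real.one_le_sqrt]
        exact_mod_cast G.one_le_disjointPairs (mt (indepSetOracle_eq_true G).2 h)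
      have hadd := mul_le_mul_of_nonneg_left (G.sqrt_disjointPairs_add_le hs
        (Finset.sdiff_subset (t := half d A)) Finset.disjoint_sdiff) (Nat.cast_nonneg (α := ℝ) d)
      refine ⟨l1 ++ l2, c1 + (c2 + 0) + 1, ?_, fun f => ?_, ?_, ?_, Returns.query ?_⟩
      · intro P hP
        rcases List.mem_append.1 hP with hP | hP
        · exact ⟨(hp1 P hP).1.trans hs, (hp1 P hP).2⟩
        · exact ⟨(hp2 P hP).1.trans Finset.sdiff_subset, (hp2 P hP).2⟩
      · rw [List.map_append, List.sum_append, hs1, hs2, add_comm, Finset.sum_sdiff hs]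
      · rw [List.length_append]
        push_cast
        linarith
      · push_cast
        linarith
      · rw [if_neg h]
        have r2' : Returns (indepSetOracle G) ((independentPieces d (A \ half d A)).bind fun l' =>
            output (l1 ++ l')) (l1 ++ l2) (c2 + 0) := r2.bind (returns_output _)
        exact r1.bind r2'

/-- Linear cost in `disjointPairs`: the number of pieces, which is squared when they are paired up,
is bounded by the square root of `disjointPairs`. -/
lemma returns_countWithin {d : ℕ} (hd1 : 1 ≤ d) {S : Finset (Fin n)} (hd : S.card ≤ 2 ^ d) :
    ∃ c : ℕ, (c : ℝ) ≤ 2 + 10 * d ^ 2 * G.disjointPairs S ∧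
      Returns (indepSetOracle G) (countWithin d S) (G.adjPairs S S) c := by
  obtain ⟨l, c₀, hl, hsum, hlen, hc₀, r₀⟩ := returns_independentPieces G d hd
  have hex : ∀ P Q, ∃ c, P ∈ l → Q ∈ l → c ≤ 1 + (4 * d + 1) * G.adjPairs Q P ∧
      Returns (indepSetOracle G) (countBetween d P Q) (G.adjPairs Q P) c := by
    intro P Q
    by_cases hP : P ∈ l
    · by_cases hQ : Q ∈ l
      · obtain ⟨c, h⟩ := returns_countBetween G (d := d) (hl P hP).2 (hl Q hQ).2
          ((Finset.card_le_card (hl P hP).1).trans hd) ((Finset.card_le_card (hl Q hQ).1).trans hd)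
        exact ⟨c, fun _ _ => h⟩
      · exact ⟨0, fun _ h => absurd h hQ⟩
    · exact ⟨0, fun h => absurd h hP⟩
  choose c hc using hex
  have hval : (l.map fun P => (l.map fun Q => G.adjPairs Q P).sum).sum = G.adjPairs S S := by
    have hin : ∀ P, (l.map fun Q => G.adjPairs Q P).sum =
        ∑ v ∈ P, ∑ u ∈ S, if G.Adj u v then 1 else 0 := fun P => by
      rw [Finset.sum_comm]
      exact hsum fun u => ∑ v ∈ P, if G.Adj u v then 1 else 0
    rw [funext hin, hsum, SimpleGraph.adjPairs, Finset.sum_comm]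
  have hcost : (l.map fun P => (l.map fun Q => c P Q).sum).sum ≤
      l.length ^ 2 + (4 * d + 1) * G.adjPairs S S := by
    calc (l.map fun P => (l.map fun Q => c P Q).sum).sum
        ≤ (l.map fun P => (l.map fun Q => 1 + (4 * d + 1) * G.adjPairs Q P).sum).sum :=
          List.sum_le_sum fun P hP => List.sum_le_sum fun Q hQ => (hc P Q hP hQ).1
      _ = l.length ^ 2 + (4 * d + 1) * G.adjPairs S S := by
          rw [← hval]
          simp only [List.sum_map_add, List.map_const', List.sum_replicate, List.sum_map_mul_left]
          simp [sq]
  refine ⟨c₀ + (l.map fun P => (l.map fun Q => c P Q).sum).sum, ?_, ?_⟩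
  · have hQ : (G.adjPairs S S : ℝ) ≤ G.disjointPairs S :=
      mod_cast G.adjPairs_self_le_disjointPairs S
    have hcost' : ((l.map fun P => (l.map fun Q => c P Q).sum).sum : ℝ) ≤
        (l.length : ℝ) ^ 2 + (4 * d + 1) * G.adjPairs S S := mod_cast hcost
    set q : ℝ := √(G.disjointPairs S : ℝ)
    have hq : q ^ 2 = G.disjointPairs S := Real.sq_sqrt (Nat.cast_nonneg _)
    have hq0 : 0 ≤ q := Real.sqrt_nonneg _
    have hqq : q ≤ q ^ 2 := by
      rw [hq]
      refine Real.sqrt_le_self_iff.2 ?_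
      exact_mod_cast Nat.eq_zero_or_pos _
    have hd1' : (1 : ℝ) ≤ d := mod_cast hd1
    have hlen2 : (l.length : ℝ) ^ 2 ≤ (1 + d * q) ^ 2 :=
      pow_le_pow_left₀ (Nat.cast_nonneg _) hlen 2
    rw [← hq] at hQ ⊢
    rw [Nat.cast_add]
    have h1 : d * q ≤ d ^ 2 * q ^ 2 := by
      have := mul_le_mul (le_self_pow₀ hd1' two_ne_zero) hqq hq0 (by positivity)
      exact this
    have h2 : (4 * d + 1) * (G.adjPairs S S : ℝ) ≤ 5 * d ^ 2 * q ^ 2 :=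
      mul_le_mul (by nlinarith) hQ (Nat.cast_nonneg _) (by positivity)
    linarith
  · refine r₀.bind ?_
    rw [← hval]
    exact returns_sumOver l fun P hP => returns_sumOver l fun Q hQ => (hc P Q hP hQ).2

end QueryAlg

namespace QueryAlg

/-! ### Random vertex sets -/

/-- A coin that shows `true` with probability `p`, where `p` is clamped to `[0, 1]`. -/
noncomputable def coin (p : ℝ) : PMF Bool :=
  PMF.ofFintype (fun b => ENNReal.ofReal (if b then max 0 (min p 1) else 1 - max 0 (min p 1))) <| by
    have h : 0 ≤ 1 - max 0 (min p 1) := by simp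
    simp only [Fintype.univ_bool, Finset.mem_singleton, Bool.true_eq_false, not_false_eq_true,
      Finset.sum_insert, Finset.sum_singleton, if_true, Bool.false_eq_true, if_false]
    rw [← ENNReal.ofReal_add (le_max_left _ _) h, add_sub_cancel, ENNReal.ofReal_one]

lemma coin_true {p : ℝ} (h0 : 0 ≤ p) (h1 : p ≤ 1) : (coin p true).toReal = p := by
  simp [coin, h0, h1]

lemma coin_false {p : ℝ} (h0 : 0 ≤ p) (h1 : p ≤ 1) : (coin p false).toReal = 1 - p := by
  simp [coin, h0, h1]

/-- A random subset of the list `l`: each entry is put in with probability `p`, independently. -/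
noncomputable def sample {n : ℕ} (p : ℝ) : List (Fin n) → QueryAlg n (Finset (Fin n))
  | [] => output ∅
  | v :: l => flip (coin p) fun b =>
      (sample p l).bind fun S => output (if b then insert v S else S)

variable {n : ℕ} {O : Finset (Fin n) → Bool}

lemma expect_sample_eq (p : ℝ) (l : List (Fin n)) (f : Finset (Fin n) × ℕ → ℝ) :
    expect O (sample p l) f = expect O (sample p l) fun r => f (r.1, 0) := by
  induction l generalizing f with
  | nil => rfl
  | cons v l ih =>
    simp only [sample, expect, expect_bind, add_zero]
    congr 2
    · exact ih fun r => f (_, r.2)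
    · exact ih fun r => f (_, r.2)

lemma expect_sample_subset {p : ℝ} (h0 : 0 ≤ p) (h1 : p ≤ 1) {l : List (Fin n)} (hl : l.Nodup)
    (A : Finset (Fin n)) :
    expect O (sample p l) (fun r => if A ⊆ r.1 then 1 else 0) =
      if A ⊆ l.toFinset then p ^ A.card else 0 := by
  induction l generalizing A with
  | nil =>
    rcases A.eq_empty_or_nonempty with rfl | h
    · simp [sample]
    · simp [sample, expect, h.ne_empty]
  | cons v l ih =>
    rw [List.nodup_cons] at hl
    simp only [sample, expect, expect_bind, coin_true h0 h1, coin_false h0 h1, if_true,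
      Bool.false_eq_true, if_false, Finset.subset_insert_iff, ih hl.2, List.toFinset_cons]
    by_cases hv : v ∈ A
    · have hA : ¬ A ⊆ l.toFinset := fun h => hl.1 (List.mem_toFinset.1 (h hv))
      rw [if_neg hA, mul_zero, add_zero, ← Finset.card_erase_add_one hv, mul_ite, mul_zero,
        pow_succ']
    · rw [Finset.erase_eq_of_notMem hv]
      ring

lemma expect_sample_univ {p : ℝ} (h0 : 0 ≤ p) (h1 : p ≤ 1) (A : Finset (Fin n)) :
    expect O (sample p (List.finRange n)) (fun r => if A ⊆ r.1 then 1 else 0) = p ^ A.card := by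
  rw [expect_sample_subset h0 h1 (List.nodup_finRange n), if_pos]
  intro v _
  simp

end QueryAlg

namespace SimpleGraph

variable {n : ℕ}

lemma card_ends {G : SimpleGraph (Fin n)} {x : Fin n × Fin n} (h : G.Adj x.1 x.2) :
    (ends x).card = 2 :=
  Finset.card_pair h.ne

variable (G : SimpleGraph (Fin n))

lemma three_le_card_ends_union {x y : Fin n × Fin n} (hx : G.Adj x.1 x.2)
    (hy : G.Adj y.1 y.2) (hxy : ends x ≠ ends y) : 3 ≤ (ends x ∪ ends y).card := by
  have hx2 := card_ends hx
  have hy2 := card_ends hy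
  by_contra! h
  have h1 := Finset.eq_of_subset_of_card_le (Finset.subset_union_left (s₁ := ends x) (s₂ := ends y))
    (by omega)
  have h2 := Finset.eq_of_subset_of_card_le (Finset.subset_union_right (s₁ := ends x) (s₂ := ends y))
    (by omega)
  exact hxy (h1.trans h2.symm)

lemma card_ends_union_of_disjoint {x y : Fin n × Fin n} (hx : G.Adj x.1 x.2)
    (hy : G.Adj y.1 y.2) (hxy : Disjoint (ends x) (ends y)) : (ends x ∪ ends y).card = 4 := by
  rw [Finset.card_union_of_disjoint hxy, card_ends hx, card_ends hy]

variable [DecidableRel G.Adj]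

lemma dartsIn_eq_filter (S : Finset (Fin n)) :
    G.dartsIn S = (G.dartsIn Finset.univ).filter fun x => ends x ⊆ S := by
  ext x
  simp [mem_dartsIn, and_comm]

lemma adj_of_mem_darts {x : Fin n × Fin n} (hx : x ∈ G.dartsIn Finset.univ) : G.Adj x.1 x.2 :=
  (G.mem_dartsIn.1 hx).2

lemma card_dartsIn_univ : (G.dartsIn Finset.univ).card = 2 * G.edgeSet.ncard := by
  rw [← SimpleGraph.coe_edgeFinset, Set.ncard_coe_finset, ← G.sum_degrees_eq_twice_card_edges,
    card_dartsIn, adjPairs]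
  refine Finset.sum_congr rfl fun u _ => ?_
  rw [← Finset.card_filter, ← G.card_neighborFinset_eq_degree, G.neighborFinset_eq_filter]

lemma card_filter_ends_eq_le (x : Fin n × Fin n) :
    ((G.dartsIn Finset.univ).filter fun y => ends x = ends y).card ≤ 2 := by
  refine (Finset.card_le_card (t := {x, x.swap}) fun y hy => ?_).trans Finset.card_le_two
  obtain ⟨hy, h⟩ := Finset.mem_filter.1 hy
  have hne := (G.adj_of_mem_darts hy).ne
  have h1 : y.1 ∈ ends x := h ▸ by simp [ends]
  have h2 : y.2 ∈ ends x := h ▸ by simp [ends]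
  simp only [ends, Finset.mem_insert, Finset.mem_singleton] at h1 h2 ⊢
  rw [Prod.ext_iff, Prod.ext_iff, Prod.fst_swap, Prod.snd_swap]
  rcases h1 with h1 | h1 <;> rcases h2 with h2 | h2 <;> simp_all

lemma card_filter_not_disjoint_le (x : Fin n × Fin n) :
    ((G.dartsIn Finset.univ).filter fun y => ¬ Disjoint (ends x) (ends y)).card ≤ 4 * n := by
  have hcard : ∀ w : Fin n, (((Finset.univ : Finset (Fin n)).image fun z => (w, z)) ∪
      (Finset.univ : Finset (Fin n)).image fun z => (z, w)).card ≤ 2 * n := fun w => by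
    refine (Finset.card_union_le _ _).trans ?_
    have h1 := Finset.card_image_le (s := (Finset.univ : Finset (Fin n))) (f := fun z => (w, z))
    have h2 := Finset.card_image_le (s := (Finset.univ : Finset (Fin n))) (f := fun z => (z, w))
    rw [Finset.card_univ, Fintype.card_fin] at h1 h2
    omega
  refine (Finset.card_le_card (t := (ends x).biUnion fun w =>
    ((Finset.univ : Finset (Fin n)).image fun z => (w, z)) ∪
      (Finset.univ : Finset (Fin n)).image fun z => (z, w)) fun y hy => ?_).trans ?_
  · obtain ⟨w, hw, hw'⟩ := Finset.not_disjoint_iff.1 (Finset.mem_filter.1 hy).2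
    refine Finset.mem_biUnion.2 ⟨w, hw, ?_⟩
    simp only [ends, Finset.mem_insert, Finset.mem_singleton] at hw'
    rcases hw' with rfl | rfl
    · exact Finset.mem_union_left _ (Finset.mem_image.2 ⟨y.2, Finset.mem_univ _, rfl⟩)
    · exact Finset.mem_union_right _ (Finset.mem_image.2 ⟨y.1, Finset.mem_univ _, rfl⟩)
  · refine (Finset.card_biUnion_le_card_mul _ _ (2 * n) fun w _ => hcard w).trans ?_
    have : (ends x).card ≤ 2 := Finset.card_le_two
    nlinarith

lemma cast_adjPairs (S : Finset (Fin n)) :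
    (G.adjPairs S S : ℝ) = ∑ x ∈ G.dartsIn Finset.univ, if ends x ⊆ S then 1 else 0 := by
  rw [← G.card_dartsIn, G.dartsIn_eq_filter S, Finset.card_filter]
  push_cast
  rfl

lemma cast_adjPairs_sq (S : Finset (Fin n)) :
    (G.adjPairs S S : ℝ) ^ 2 = ∑ x ∈ G.dartsIn Finset.univ, ∑ y ∈ G.dartsIn Finset.univ,
      if ends x ∪ ends y ⊆ S then 1 else 0 := by
  rw [sq, cast_adjPairs, Finset.sum_mul_sum]
  refine Finset.sum_congr rfl fun x _ => Finset.sum_congr rfl fun y _ => ?_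
  rw [ite_zero_mul_ite_zero, one_mul]
  simp only [Finset.union_subset_iff]

lemma cast_disjointPairs (S : Finset (Fin n)) :
    (G.disjointPairs S : ℝ) = ∑ x ∈ G.dartsIn Finset.univ, ∑ y ∈ G.dartsIn Finset.univ,
      (if x = y ∨ Disjoint (ends x) (ends y) then 1 else 0) *
        if ends x ∪ ends y ⊆ S then 1 else 0 := by
  rw [disjointPairs, Finset.card_filter, Finset.sum_product, G.dartsIn_eq_filter S,
    Finset.sum_filter]
  push_cast
  refine Finset.sum_congr rfl fun x _ => ?_
  rw [Finset.sum_filter]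
  by_cases hx : ends x ⊆ S
  · rw [if_pos hx]
    refine Finset.sum_congr rfl fun y _ => ?_
    by_cases hy : ends y ⊆ S <;> simp [hx, hy, Finset.union_subset_iff]
  · simp [hx, Finset.union_subset_iff]

end SimpleGraph

namespace QueryAlg

open SimpleGraph (ends)

variable {n : ℕ} (G : SimpleGraph (Fin n)) [DecidableRel G.Adj] {O : Finset (Fin n) → Bool}

lemma expect_adjPairs {p : ℝ} (h0 : 0 ≤ p) (h1 : p ≤ 1) :
    expect O (sample p (List.finRange n)) (fun r => (G.adjPairs r.1 r.1 : ℝ)) =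
      (G.dartsIn Finset.univ).card * p ^ 2 := by
  simp only [G.cast_adjPairs, expect_sum, expect_sample_univ h0 h1]
  rw [Finset.sum_congr rfl fun x hx => by rw [SimpleGraph.card_ends (G.adj_of_mem_darts hx)],
    Finset.sum_const, nsmul_eq_mul]

/-- Pairs of edges without a common vertex are independent and contribute at most the square of the
expectation; an edge shares a vertex with at most `2 n` others, which bounds the rest. -/
lemma expect_sq_adjPairs_le {p : ℝ} (h0 : 0 ≤ p) (h1 : p ≤ 1) :
    expect O (sample p (List.finRange n)) (fun r => (G.adjPairs r.1 r.1 : ℝ) ^ 2) ≤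
      ((G.dartsIn Finset.univ).card * p ^ 2) ^ 2 +
        (G.dartsIn Finset.univ).card * (4 * n * p ^ 3 + 2 * p ^ 2) := by
  simp only [G.cast_adjPairs_sq, expect_sum, expect_sample_univ h0 h1]
  set D := G.dartsIn Finset.univ
  have hrow : ∀ x ∈ D, ∑ y ∈ D, p ^ (ends x ∪ ends y).card ≤
      D.card * p ^ 4 + (4 * n * p ^ 3 + 2 * p ^ 2) := fun x hx => by
    have hx' := G.adj_of_mem_darts hx
    calc ∑ y ∈ D, p ^ (ends x ∪ ends y).card
        ≤ ∑ y ∈ D, (p ^ 4 + ((if ¬ Disjoint (ends x) (ends y) then 1 else 0) * p ^ 3 +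
            (if ends x = ends y then 1 else 0) * p ^ 2)) := by
          refine Finset.sum_le_sum fun y hy => ?_
          have hy' := G.adj_of_mem_darts hy
          by_cases hd : Disjoint (ends x) (ends y)
          · rw [G.card_ends_union_of_disjoint hx' hy' hd]
            have : 0 ≤ (if ends x = ends y then (1 : ℝ) else 0) * p ^ 2 := by positivity
            simpa [hd] using this
          · by_cases he : ends x = ends y
            · rw [← he, Finset.union_self, SimpleGraph.card_ends hx', if_pos rfl]
              have : 0 ≤ (if ¬ Disjoint (ends x) (ends x) then (1 : ℝ) else 0) * p ^ 3 := by
                positivity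
              nlinarith [pow_nonneg h0 4]
            · have := pow_le_pow_of_le_one h0 h1 (G.three_le_card_ends_union hx' hy' he)
              simp only [hd, he, not_false_eq_true, if_true, if_false]
              nlinarith [pow_nonneg h0 4]
      _ = D.card * p ^ 4 + ((D.filter fun y => ¬ Disjoint (ends x) (ends y)).card * p ^ 3 +
            (D.filter fun y => ends x = ends y).card * p ^ 2) := by
          rw [Finset.sum_add_distrib, Finset.sum_add_distrib, ← Finset.sum_mul, ← Finset.sum_mul,
            Finset.sum_boole, Finset.sum_boole, Finset.sum_const, nsmul_eq_mul]
      _ ≤ D.card * p ^ 4 + (4 * n * p ^ 3 + 2 * p ^ 2) := by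
          have a : ((D.filter fun y => ¬ Disjoint (ends x) (ends y)).card : ℝ) ≤ 4 * n :=
            mod_cast G.card_filter_not_disjoint_le x
          have b : ((D.filter fun y => ends x = ends y).card : ℝ) ≤ 2 :=
            mod_cast G.card_filter_ends_eq_le x
          gcongr
  refine (Finset.sum_le_sum hrow).trans (le_of_eq ?_)
  rw [Finset.sum_const, nsmul_eq_mul]
  ring

lemma expect_disjointPairs_le {p : ℝ} (h0 : 0 ≤ p) (h1 : p ≤ 1) :
    expect O (sample p (List.finRange n)) (fun r => (G.disjointPairs r.1 : ℝ)) ≤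
      (G.dartsIn Finset.univ).card * p ^ 2 + ((G.dartsIn Finset.univ).card * p ^ 2) ^ 2 := by
  simp only [G.cast_disjointPairs, expect_sum, expect_mul_left, expect_sample_univ h0 h1]
  set D := G.dartsIn Finset.univ
  have hrow : ∀ x ∈ D, ∑ y ∈ D, (if x = y ∨ Disjoint (ends x) (ends y) then (1 : ℝ) else 0) *
      p ^ (ends x ∪ ends y).card ≤ p ^ 2 + D.card * p ^ 4 := fun x hx => by
    have hx' := G.adj_of_mem_darts hx
    calc ∑ y ∈ D, (if x = y ∨ Disjoint (ends x) (ends y) then (1 : ℝ) else 0) *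
          p ^ (ends x ∪ ends y).card
        ≤ ∑ y ∈ D, ((if x = y then p ^ 2 else 0) + p ^ 4) := by
          refine Finset.sum_le_sum fun y hy => ?_
          have hy' := G.adj_of_mem_darts hy
          have h4 := pow_nonneg h0 4
          by_cases he : x = y
          · rw [← he, Finset.union_self, SimpleGraph.card_ends hx']
            simpa using h4
          · by_cases hd : Disjoint (ends x) (ends y)
            · rw [G.card_ends_union_of_disjoint hx' hy' hd]
              simp [he, hd]
            · simpa [he, hd] using h4
      _ = p ^ 2 + D.card * p ^ 4 := by
          rw [Finset.sum_add_distrib, Finset.sum_ite_eq, if_pos hx, Finset.sum_const, nsmul_eq_mul]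
  refine (Finset.sum_le_sum hrow).trans (le_of_eq ?_)
  rw [Finset.sum_const, nsmul_eq_mul]
  ring

end QueryAlg

namespace QueryAlg

/-! ### Repetition and the search for the right scale -/

variable {n : ℕ} {O : Finset (Fin n) → Bool}

/-- Runs `A` independently `M` times and adds up the outputs. -/
def repeatSum (A : QueryAlg n ℕ) : ℕ → QueryAlg n ℕ
  | 0 => output 0
  | M + 1 => A.bind fun a => (repeatSum A M).bind fun b => output (a + b)

lemma expect_add_const (A : QueryAlg n ℕ) (f : ℕ × ℕ → ℝ) (c : ℝ) :
    expect O A (fun r => f r + c) = expect O A f + c := by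
  rw [expect_add, expect_const]

lemma expect_sub_mean (A : QueryAlg n ℕ) {μ : ℝ} (h : expect O A (fun r => (r.1 : ℝ)) = μ) :
    expect O A (fun r => (r.1 : ℝ) - μ) = 0 := by
  simp only [sub_eq_add_neg]
  rw [expect_add_const, h, add_neg_cancel]

lemma expect_repeatSum_cost_le {A : QueryAlg n ℕ} {κ : ℝ}
    (h : expect O A (fun r => (r.2 : ℝ)) ≤ κ) (M : ℕ) :
    expect O (repeatSum A M) (fun r => (r.2 : ℝ)) ≤ M * κ := by
  induction M with
  | zero => simp [repeatSum, expect]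
  | succ M ih =>
    simp only [repeatSum, expect_bind, expect, add_zero, Nat.cast_add, expect_add, expect_const]
    push_cast
    linarith

/-- The variances of independent repetitions add up. -/
lemma expect_repeatSum_sq_le {A : QueryAlg n ℕ} {μ v : ℝ}
    (h : expect O A (fun r => (r.1 : ℝ)) = μ) (hv : expect O A (fun r => ((r.1 : ℝ) - μ) ^ 2) ≤ v)
    (M : ℕ) : expect O (repeatSum A M) (fun r => ((r.1 : ℝ) - M * μ) ^ 2) ≤ M * v := by
  induction M with
  | zero => simp [repeatSum, expect]
  | succ M ih =>
    have hsq : ∀ a b : ℕ, (((a + b : ℕ) : ℝ) - (M + 1 : ℕ) * μ) ^ 2 =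
        (((a : ℝ) - μ) ^ 2 + ((a : ℝ) - μ) * (2 * ((b : ℝ) - M * μ))) + ((b : ℝ) - M * μ) ^ 2 := by
      intro a b
      push_cast
      ring
    simp only [repeatSum, expect_bind, expect, hsq, expect_add, expect_const]
    have hcross : ∀ r : ℕ × ℕ, expect O (repeatSum A M)
        (fun s => ((r.1 : ℝ) - μ) * (2 * ((s.1 : ℝ) - M * μ))) =
        expect O (repeatSum A M) (fun s => 2 * ((s.1 : ℝ) - M * μ)) * ((r.1 : ℝ) - μ) := by
      intro r
      rw [expect_mul_left, mul_comm]
    simp only [hcross, expect_mul_left, expect_sub_mean A h]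
    push_cast
    linarith

open Classical in
/-- Runs the stages `t, t + 1, …`, at most `k` of them, up to the first one whose outcome `s`
satisfies `accept`, and outputs `out` of it; outputs `0` if there is none. -/
noncomputable def firstStop (stage : ℕ → QueryAlg n ℕ) (accept : ℕ → ℕ → Prop) (out : ℕ → ℕ → ℝ) :
    ℕ → ℕ → QueryAlg n ℝ
  | 0, _ => output 0
  | k + 1, t => (stage t).bind fun s =>
      if accept t s then output (out t s) else firstStop stage accept out k (t + 1)

open Classical in
/-- `D t s` bounds the indicator that the outcome `s` of stage `t` is atypical. If typical outcomes
lead to good outputs and stage `T` stops on a typical outcome, then `firstStop` fails only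
when one of the stages up to `T` is atypical (union bound) or when these stages together take more
than `B` queries (Markov's inequality). The number `c₀` counts the queries made earlier. -/
lemma expect_firstStop_le {stage : ℕ → QueryAlg n ℕ} {accept : ℕ → ℕ → Prop} {out : ℕ → ℕ → ℝ}
    {T : ℕ} {good : Set ℝ} [DecidablePred (· ∈ good)] {D : ℕ → ℕ → ℝ} {η B : ℝ} {κ : ℕ → ℝ}
    (hB : 0 < B) (hη : 0 ≤ η)
    (hκ : ∀ t, 0 ≤ κ t) (hD0 : ∀ t s, 0 ≤ D t s)
    (hD : ∀ t ≤ T, expect O (stage t) (fun r => D t r.1) ≤ η)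
    (hcost : ∀ t ≤ T, expect O (stage t) (fun r => (r.2 : ℝ)) ≤ κ t)
    (hgood : ∀ t ≤ T, ∀ s, D t s < 1 → accept t s → out t s ∈ good)
    (haccept : ∀ s, D T s < 1 → accept T s) (k t c₀ : ℕ) (ht : t ≤ T) (hk : T < t + k) :
    expect O (firstStop stage accept out k t)
        (fun r => if ((c₀ + r.2 : ℕ) : ℝ) ≤ B ∧ r.1 ∈ good then 0 else 1) ≤
      (T + 1 - t) * η + (c₀ + ∑ i ∈ Finset.Ico t (T + 1), κ i) / B := by
  induction k generalizing t c₀ with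
  | zero => omega
  | succ k ih =>
    have hle1 : ∀ (A : QueryAlg n ℝ) (c : ℕ), expect O A
        (fun r => if ((c + r.2 : ℕ) : ℝ) ≤ B ∧ r.1 ∈ good then 0 else 1) ≤ 1 := fun A c =>
      (expect_mono A fun r => by split_ifs <;> norm_num).trans (expect_const A 1).le
    have htT : (t : ℝ) ≤ T := mod_cast ht
    have hS : 0 ≤ ∑ i ∈ Finset.Ico (t + 1) (T + 1), κ i := Finset.sum_nonneg fun i _ => hκ i
    have hpt : ∀ r : ℕ × ℕ, expect O
        (if accept t r.1 then output (out t r.1) else firstStop stage accept out k (t + 1))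
        (fun s => if ((c₀ + (r.2 + s.2) : ℕ) : ℝ) ≤ B ∧ s.1 ∈ good then 0 else 1) ≤
        (D t r.1 + B⁻¹ * r.2) +
          ((T - t) * η + (c₀ + ∑ i ∈ Finset.Ico (t + 1) (T + 1), κ i) / B) := by
      intro r
      simp only [← add_assoc]
      have h1 : 0 ≤ B⁻¹ * r.2 := by positivity
      have h2 : 0 ≤ (T - t) * η := mul_nonneg (by linarith) hη
      have h3 : 0 ≤ (c₀ + ∑ i ∈ Finset.Ico (t + 1) (T + 1), κ i) / B := by positivity
      have h4 := hD0 t r.1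
      by_cases hd : D t r.1 < 1
      · by_cases hs : accept t r.1
        · rw [if_pos hs, expect]
          split_ifs with hif
          · linarith
          · have hlt : B < c₀ + r.2 := by
              by_contra! hcon
              exact hif ⟨by simpa using hcon, hgood t ht r.1 hd hs⟩
            have : 1 ≤ (c₀ + r.2) / B := (one_le_div hB).2 hlt.le
            have h5 : (c₀ + r.2) / B = B⁻¹ * r.2 + c₀ / B := by field_simp; ring
            have h6 : c₀ / B ≤ (c₀ + ∑ i ∈ Finset.Ico (t + 1) (T + 1), κ i) / B := by
              gcongr
              linarith
            linarith
        · rw [if_neg hs]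
          have hne : t ≠ T := fun h => hs (h ▸ haccept r.1 (h ▸ hd))
          refine (ih (t + 1) (c₀ + r.2) (by omega) (by omega)).trans ?_
          have h5 : (((c₀ + r.2 : ℕ) : ℝ) + ∑ i ∈ Finset.Ico (t + 1) (T + 1), κ i) / B =
              B⁻¹ * r.2 + (c₀ + ∑ i ∈ Finset.Ico (t + 1) (T + 1), κ i) / B := by
            push_cast
            field_simp
            ring
          have h6 : ((T : ℝ) + 1 - (t + 1 : ℕ)) * η = (T - t) * η := by push_cast; ring
          rw [h5, h6]
          linarith
      · rw [not_lt] at hd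
        have := hle1 (if accept t r.1 then output (out t r.1) else firstStop stage accept out k (t + 1))
          (c₀ + r.2)
        linarith
    rw [firstStop, expect_bind]
    refine (expect_mono _ hpt).trans ?_
    rw [expect_add, expect_add, expect_const, expect_mul_left]
    have h1 := hD t ht
    have h2 := mul_le_mul_of_nonneg_left (hcost t ht) (inv_nonneg.2 hB.le)
    rw [Finset.sum_eq_sum_Ico_succ_bot (by omega : t < T + 1)]
    have h5 : (c₀ + (κ t + ∑ i ∈ Finset.Ico (t + 1) (T + 1), κ i)) / B =
        B⁻¹ * κ t + (c₀ + ∑ i ∈ Finset.Ico (t + 1) (T + 1), κ i) / B := by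
      field_simp
      ring
    rw [h5]
    linarith

/-- Counts the ordered pairs of adjacent vertices in a random set of density `p`. -/
noncomputable def sampleCount (n d : ℕ) (p : ℝ) : QueryAlg n ℕ :=
  (sample p (List.finRange n)).bind (countWithin d)

section Moments

variable (G : SimpleGraph (Fin n)) [DecidableRel G.Adj] {d : ℕ} {p : ℝ}

lemma expect_sampleCount (hd1 : 1 ≤ d) (hd : n ≤ 2 ^ d) (f : ℕ → ℝ) :
    expect (indepSetOracle G) (sampleCount n d p) (fun r => f r.1) =
      expect (indepSetOracle G) (sample p (List.finRange n))
        fun r => f (G.adjPairs r.1 r.1) := by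
  have hS : ∀ S : Finset (Fin n), S.card ≤ 2 ^ d := fun S => (card_finset_fin_le S).trans hd
  rw [sampleCount, expect_bind]
  congr 1
  funext r
  obtain ⟨c, -, hc⟩ := returns_countWithin G hd1 (hS r.1)
  rw [hc]

lemma expect_sampleCount_cost_le (hd1 : 1 ≤ d) (hd : n ≤ 2 ^ d) (h0 : 0 ≤ p) (h1 : p ≤ 1)
    (hp : (G.dartsIn Finset.univ).card * p ^ 2 ≤ 2) :
    expect (indepSetOracle G) (sampleCount n d p) (fun r => (r.2 : ℝ)) ≤ 62 * d ^ 2 := by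
  have hS : ∀ S : Finset (Fin n), S.card ≤ 2 ^ d := fun S => (card_finset_fin_le S).trans hd
  rw [sampleCount, expect_bind, expect_sample_eq]
  have hpt : ∀ r : Finset (Fin n) × ℕ, expect (indepSetOracle G) (countWithin d r.1)
      (fun s => ((0 + s.2 : ℕ) : ℝ)) ≤ 2 + 10 * d ^ 2 * G.disjointPairs r.1 := by
    intro r
    obtain ⟨c, hc, hr⟩ := returns_countWithin G hd1 (hS r.1)
    rw [hr, zero_add]
    exact hc
  refine (expect_mono _ hpt).trans ?_
  rw [expect_add, expect_const, expect_mul_left]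
  have hQ := expect_disjointPairs_le G (O := indepSetOracle G) h0 h1
  have h6 : (G.dartsIn Finset.univ).card * p ^ 2 + ((G.dartsIn Finset.univ).card * p ^ 2) ^ 2 ≤
      (6 : ℝ) := by
    have : (0 : ℝ) ≤ (G.dartsIn Finset.univ).card * p ^ 2 := by positivity
    nlinarith
  have hd' : (1 : ℝ) ≤ (d : ℝ) ^ 2 := one_le_pow₀ (mod_cast hd1)
  have := mul_le_mul_of_nonneg_left (hQ.trans h6) (by positivity : (0 : ℝ) ≤ 10 * d ^ 2)
  linarith

lemma expect_sampleCount_sq_le (hd1 : 1 ≤ d) (hd : n ≤ 2 ^ d) (h0 : 0 ≤ p) (h1 : p ≤ 1)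
    (hp : (G.dartsIn Finset.univ).card * p ^ 2 ≤ 2) (hn : 1 ≤ n * p) :
    expect (indepSetOracle G) (sampleCount n d p)
      (fun r => ((r.1 : ℝ) - (G.dartsIn Finset.univ).card * p ^ 2) ^ 2) ≤ 12 * (n * p) := by
  rw [expect_sampleCount G hd1 hd fun s => ((s : ℝ) - (G.dartsIn Finset.univ).card * p ^ 2) ^ 2]
  set μ : ℝ := (G.dartsIn Finset.univ).card * p ^ 2 with hμ
  have hexp : ∀ x : ℝ, (x - μ) ^ 2 = (x ^ 2 + (-2 * μ) * x) + μ ^ 2 := fun x => by ring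
  simp only [hexp]
  rw [expect_add, expect_add, expect_const, expect_mul_left, expect_adjPairs G h0 h1]
  have h2 := expect_sq_adjPairs_le G (O := indepSetOracle G) h0 h1
  have h3 : (G.dartsIn Finset.univ).card * (4 * n * p ^ 3 + 2 * p ^ 2) =
      μ * (4 * (n * p) + 2) := by rw [hμ]; ring
  rw [h3] at h2
  have h4 : μ * (4 * (n * p) + 2) ≤ 2 * (4 * (n * p) + 2) :=
    mul_le_mul_of_nonneg_right hp (by linarith)
  rw [← hμ] at h2 ⊢
  linarith

end Moments

end QueryAlg

namespace QueryAlg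

/-! ### The estimator -/

/-- The logarithmic factor `⌊log₂ n⌋ + 1` of the algorithm: a bound on the depth of the halvings and
on the number of stages. -/
def depth (n : ℕ) : ℕ := Nat.log 2 n + 1

/-- The factor by which the number of samples is increased to make the variance small. The constant
makes the bound `12 * 2 ^ t / ((ε / 8) ^ 2 * (2 ^ t * K))` that Chebyshev's inequality gives for the
failure of one stage with oversampling factor `K` at most `1 / depth n ^ 2`. -/
noncomputable def oversampling (ε : ℝ) (n : ℕ) : ℕ := ⌈768 * (depth n : ℝ) ^ 2 / ε ^ 2⌉₊

/-- The edge estimator. Stage `t` counts the edges in `2 ^ t * oversampling ε n` random sets of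
density `p = 2 ^ t / n`. It is accepted if each sample holds `1 / 8` edge on average, which shows
that `1 / p ^ 2` is not much larger than the number of edges. Edges are counted in both
orientations. -/
noncomputable def estimateEdges (ε : ℝ) (n : ℕ) : QueryAlg n ℝ :=
  firstStop (fun t => repeatSum (sampleCount n (depth n) (2 ^ t / n)) (2 ^ t * oversampling ε n))
    (fun t s => ((2 ^ t * oversampling ε n : ℕ) : ℝ) ≤ 4 * s)
    (fun t s => s / (2 * (2 ^ t * oversampling ε n : ℕ) * (2 ^ t / n) ^ 2)) (depth n) 0

lemma le_two_pow_depth (n : ℕ) : n ≤ 2 ^ depth n :=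
  (Nat.lt_pow_succ_log_self one_lt_two n).le

lemma tendsto_two_div_depth :
    Filter.Tendsto (fun n => 2 / (depth n : ℝ)) Filter.atTop (nhds 0) := by
  refine Filter.Tendsto.const_div_atTop (tendsto_natCast_atTop_atTop.comp ?_) 2
  refine Filter.tendsto_atTop_mono (f := fun n => Nat.log 2 n) (fun n => Nat.le_succ _) ?_
  refine Filter.tendsto_atTop_atTop.2 fun b => ⟨2 ^ b, fun a ha => ?_⟩
  exact (Nat.log_pow one_lt_two b).symm.le.trans (Nat.log_mono_right ha)

lemma depth_le {n : ℕ} (hn : 2 ≤ n) : (depth n : ℝ) ≤ 3 * Real.log n := by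
  have h1 : (Nat.log 2 n : ℝ) ≤ Real.log n / Real.log 2 := by
    simpa [Real.logb] using Real.natLog_le_logb n 2
  have h2 := Real.log_two_gt_d9
  have h3 : Real.log 2 ≤ Real.log n := Real.log_le_log two_pos (mod_cast hn)
  have h4 : Real.log n / Real.log 2 ≤ 3 / 2 * Real.log n := by
    rw [div_le_iff₀ (by linarith)]
    nlinarith
  rw [depth]
  push_cast
  linarith

lemma le_oversampling {ε : ℝ} (n : ℕ) : 768 * (depth n : ℝ) ^ 2 / ε ^ 2 ≤ oversampling ε n :=
  Nat.le_ceil _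

lemma one_le_depth (n : ℕ) : (1 : ℝ) ≤ depth n := by
  rw [depth]
  push_cast
  linarith [Nat.cast_nonneg (α := ℝ) (Nat.log 2 n)]

lemma oversampling_pos {ε : ℝ} (h0 : 0 < ε) (n : ℕ) : (0 : ℝ) < oversampling ε n := by
  have := one_le_depth n
  exact lt_of_lt_of_le (by positivity) (le_oversampling n)

lemma oversampling_le {ε : ℝ} (h0 : 0 < ε) (h1 : ε < 1) (n : ℕ) :
    (oversampling ε n : ℝ) ≤ 769 * (depth n : ℝ) ^ 2 * (1 / ε) ^ 2 := by
  have hL := one_le_depth n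
  have h := (Nat.ceil_lt_add_one (a := 768 * (depth n : ℝ) ^ 2 / ε ^ 2) (by positivity)).le
  have h2 : 1 ≤ (depth n : ℝ) ^ 2 * (1 / ε) ^ 2 :=
    one_le_mul_of_one_le_of_one_le (one_le_pow₀ hL) (one_le_pow₀ ((one_le_div h0).2 h1.le))
  have h3 : 768 * (depth n : ℝ) ^ 2 / ε ^ 2 = 768 * ((depth n : ℝ) ^ 2 * (1 / ε) ^ 2) := by
    field_simp
  rw [← oversampling, h3] at h
  linarith

/-- With `4 ^ T ≤ n ^ 2 / m < 4 ^ (T + 1)`, the stages up to `T` have `m p ^ 2 ≤ 1`, so that their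
samples are cheap and concentrated, and stage `T` has `m p ^ 2 > 1 / 4`, so that it is accepted. -/
lemma expect_estimateEdges_le {ε : ℝ} (h0 : 0 < ε) (h1 : ε < 1) {n : ℕ}
    (G : SimpleGraph (Fin n)) [DecidableRel G.Adj] {m T : ℕ} (hm : m = G.edgeSet.ncard)
    (hm1 : 1 ≤ m)
    (hT : m * 4 ^ T ≤ n ^ 2) (hT' : n ^ 2 < m * 4 ^ (T + 1)) :
    expect (indepSetOracle G) (estimateEdges ε n)
        (fun r => if ((0 + r.2 : ℕ) : ℝ) ≤
            depth n * (2 ^ (T + 1) * (oversampling ε n * (62 * depth n ^ 2))) ∧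
          r.1 ∈ Set.Icc ((1 - ε) * m) ((1 + ε) * m) then 0 else 1) ≤ 2 / depth n := by
  have hL := one_le_depth n
  have hL1 : 1 ≤ depth n := mod_cast hL
  have hK := oversampling_pos h0 n
  have hKle := le_oversampling (ε := ε) n
  have hn : 0 < n := by
    rcases Nat.eq_zero_or_pos n with rfl | h
    · have : 0 < m * 4 ^ T := by positivity
      omega
    · exact h
  have hnR : (0 : ℝ) < n := mod_cast hn
  have hmR : (1 : ℝ) ≤ m := mod_cast hm1
  have hcard : ((G.dartsIn Finset.univ).card : ℝ) = 2 * m := by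
    rw [G.card_dartsIn_univ, ← hm]; push_cast; rfl
  set L := depth n with hLdef
  set K := oversampling ε n with hKdef
  have hsqt : ∀ t : ℕ, ((2 : ℝ) ^ t) ^ 2 = 4 ^ t := fun t => by
    rw [← pow_mul, mul_comm, pow_mul]; norm_num
  have hp0 : ∀ t : ℕ, (0 : ℝ) < 2 ^ t / n := fun t => by positivity
  have hmp : ∀ t ≤ T, (m : ℝ) * (2 ^ t / n) ^ 2 ≤ 1 := fun t ht => by
    rw [div_pow, hsqt, ← mul_div_assoc, div_le_one (by positivity)]
    have : m * 4 ^ t ≤ n ^ 2 :=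
      (Nat.mul_le_mul_left _ (Nat.pow_le_pow_right (by norm_num) ht)).trans hT
    exact_mod_cast this
  have hp1 : ∀ t ≤ T, (2 : ℝ) ^ t / n ≤ 1 := fun t ht => by
    have := hmp t ht
    have hp := hp0 t
    by_contra! h
    nlinarith
  have hdarts : ∀ t ≤ T, ((G.dartsIn Finset.univ).card : ℝ) * (2 ^ t / n) ^ 2 ≤ 2 := fun t ht => by
    rw [hcard]; linarith [hmp t ht]
  have hnp : ∀ t : ℕ, (n : ℝ) * (2 ^ t / n) = 2 ^ t := fun t => by field_simp
  have hM : ∀ t : ℕ, (0 : ℝ) < ((2 ^ t * K : ℕ) : ℝ) := fun t => by push_cast; positivity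
  have hTL : T + 1 ≤ L := by
    have h2 : (2 ^ T) ^ 2 ≤ n ^ 2 := by
      rw [← pow_mul, mul_comm, pow_mul]
      exact (Nat.le_mul_of_pos_left _ hm1).trans hT
    exact Nat.succ_le_succ <| Nat.le_log_of_pow_le one_lt_two <|
      (Nat.pow_le_pow_iff_left two_ne_zero).1 h2
  have hdev : ∀ t s : ℕ, ((s : ℝ) - (2 ^ t * K : ℕ) * (2 * m * (2 ^ t / n) ^ 2)) ^ 2 /
      (ε / 8 * (2 ^ t * K : ℕ)) ^ 2 < 1 →
      |(s : ℝ) - (2 ^ t * K : ℕ) * (2 * m * (2 ^ t / n) ^ 2)| < ε / 8 * (2 ^ t * K : ℕ) := by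
    intro t s h
    have hpos : 0 < ε / 8 * ((2 ^ t * K : ℕ) : ℝ) := mul_pos (by linarith) (hM t)
    rw [div_lt_one (by positivity)] at h
    exact abs_lt_of_sq_lt_sq h hpos.le
  have main := expect_firstStop_le (O := indepSetOracle G)
    (stage := fun t => repeatSum (sampleCount n L (2 ^ t / n)) (2 ^ t * K))
    (accept := fun t s => ((2 ^ t * K : ℕ) : ℝ) ≤ 4 * s)
    (out := fun t s => s / (2 * (2 ^ t * K : ℕ) * (2 ^ t / n) ^ 2))
    (T := T) (good := Set.Icc ((1 - ε) * m) ((1 + ε) * m))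
    (D := fun t s => ((s : ℝ) - (2 ^ t * K : ℕ) * (2 * m * (2 ^ t / n) ^ 2)) ^ 2 /
      (ε / 8 * (2 ^ t * K : ℕ)) ^ 2)
    (η := 1 / L ^ 2) (κ := fun t => 2 ^ t * (K * (62 * L ^ 2)))
    (B := L * (2 ^ (T + 1) * (K * (62 * L ^ 2)))) (by positivity) (by positivity)
    (fun t => by positivity) (fun t s => by positivity) ?_ ?_ ?_ ?_ L 0 0 (Nat.zero_le _) (by omega)
  · refine main.trans ?_
    rw [← Finset.range_eq_Ico, ← Finset.sum_mul, geom_sum_eq (by norm_num)]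
    have hsum : ((0 : ℕ) + ((2 : ℝ) ^ (T + 1) - 1) / (2 - 1) * (K * (62 * L ^ 2))) /
        (L * (2 ^ (T + 1) * (K * (62 * L ^ 2)))) ≤ 1 / L := by
      rw [div_le_div_iff₀ (by positivity) (by positivity)]
      have : 0 ≤ (L : ℝ) * (K * (62 * L ^ 2)) := by positivity
      push_cast
      nlinarith
    have hTL' : (T : ℝ) + 1 ≤ L := mod_cast hTL
    have heta : ((T : ℝ) + 1 - (0 : ℕ)) * (1 / (L : ℝ) ^ 2) ≤ 1 / L := by
      rw [mul_one_div, div_le_div_iff₀ (by positivity) (by positivity)]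
      push_cast
      nlinarith
    have : 2 / (L : ℝ) = 1 / L + 1 / L := by ring
    rw [this]
    exact add_le_add heta hsum
  · intro t ht
    have hmean : expect (indepSetOracle G) (sampleCount n L (2 ^ t / n)) (fun r => (r.1 : ℝ)) =
        2 * m * (2 ^ t / n) ^ 2 := by
      rw [expect_sampleCount G hL1 (le_two_pow_depth n) fun s => (s : ℝ),
        expect_adjPairs G (hp0 t).le (hp1 t ht), hcard]
    have hvar := expect_sampleCount_sq_le G hL1 (le_two_pow_depth n) (hp0 t).le (hp1 t ht)
      (hdarts t ht) (by rw [hnp]; exact one_le_pow₀ one_le_two)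
    rw [hcard, hnp] at hvar
    have h := expect_repeatSum_sq_le hmean hvar (2 ^ t * K)
    have hpos := hM t
    simp only [div_eq_inv_mul _ ((ε / 8 * ((2 ^ t * K : ℕ) : ℝ)) ^ 2), expect_mul_left]
    refine (mul_le_mul_of_nonneg_left h (by positivity)).trans ?_
    rw [div_le_iff₀ (by positivity)] at hKle
    rw [inv_mul_le_iff₀ (by positivity), mul_one_div, le_div_iff₀ (by positivity)]
    push_cast
    have h2 : (0 : ℝ) ≤ (2 ^ t) ^ 2 * K / 64 := by positivity
    have := mul_le_mul_of_nonneg_left hKle h2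
    nlinarith
  · intro t ht
    have h := expect_repeatSum_cost_le (expect_sampleCount_cost_le G hL1 (le_two_pow_depth n)
      (hp0 t).le (hp1 t ht) (hdarts t ht)) (2 ^ t * K)
    refine h.trans (le_of_eq ?_)
    push_cast
    ring
  · intro t _ s hs hst
    have h := abs_lt.1 (hdev t s hs)
    have hMt := hM t
    have hp := hp0 t
    set M : ℝ := ((2 ^ t * K : ℕ) : ℝ)
    set p : ℝ := 2 ^ t / n
    have hMp : 0 < 2 * M * p ^ 2 := by positivity
    have hεM : ε * M ≤ 1 * M := mul_le_mul_of_nonneg_right h1.le hMt.le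
    -- acceptance forces the expected count to be at least `M / 8`
    have hbig : M / 8 ≤ M * (2 * m * p ^ 2) := by linarith
    have hε : ε / 8 * M ≤ ε * (M * (2 * m * p ^ 2)) := by
      have := mul_le_mul_of_nonneg_left hbig h0.le
      linarith
    constructor
    · rw [le_div_iff₀ hMp]
      linarith
    · rw [div_le_iff₀ hMp]
      linarith
  · intro s hs
    have h := abs_lt.1 (hdev T s hs)
    have hMt := hM T
    have hmp' : 1 / 4 ≤ (m : ℝ) * (2 ^ T / n) ^ 2 := by
      rw [div_pow, hsqt, ← mul_div_assoc, le_div_iff₀ (by positivity)]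
      have : (n : ℝ) ^ 2 < m * 4 ^ (T + 1) := mod_cast hT'
      rw [pow_succ (4 : ℝ) T] at this
      linarith
    set M : ℝ := ((2 ^ T * K : ℕ) : ℝ)
    set p : ℝ := 2 ^ T / n
    have hεM : ε * M ≤ 1 * M := mul_le_mul_of_nonneg_right h1.le hMt.le
    have := mul_le_mul_of_nonneg_left hmp' hMt.le
    linarith

/-- The query bound of `estimateEdges` in the form `n / √m` times polylogarithmic factors. -/
lemma queryBound_le {ε : ℝ} (h0 : 0 < ε) (h1 : ε < 1) {n m T : ℕ} (hn : 2 ≤ n) (hm1 : 1 ≤ m)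
    (hT : m * 4 ^ T ≤ n ^ 2) :
    depth n * (2 ^ (T + 1) * (oversampling ε n * (62 * depth n ^ 2))) ≤
      ((n : ℝ) / √(m : ℝ)) * (124 * 769 * 243 * Real.log (n : ℝ) ^ 5 * (1 / ε) ^ 5) := by
  have hL := one_le_depth n
  have hmR : (0 : ℝ) < √(m : ℝ) := Real.sqrt_pos.2 (mod_cast hm1)
  have h2T : (2 : ℝ) ^ T ≤ n / √(m : ℝ) := by
    rw [le_div_iff₀ hmR]
    refine abs_le_of_sq_le_sq' ?_ (Nat.cast_nonneg n) |>.2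
    rw [mul_pow, Real.sq_sqrt (Nat.cast_nonneg m), ← pow_mul, mul_comm T 2, pow_mul, mul_comm]
    norm_num
    exact_mod_cast hT
  have hε1 : 1 ≤ 1 / ε := (one_le_div h0).2 h1.le
  have hε : (1 / ε) ^ 2 ≤ (1 / ε) ^ 5 := pow_le_pow_right₀ hε1 (by norm_num)
  have hL5 : (depth n : ℝ) ^ 5 ≤ (3 * Real.log n) ^ 5 :=
    pow_le_pow_left₀ (by linarith) (depth_le hn) 5
  calc (depth n : ℝ) * (2 ^ (T + 1) * (oversampling ε n * (62 * depth n ^ 2)))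
      = 2 ^ T * (124 * (depth n : ℝ) ^ 3 * oversampling ε n) := by ring
    _ ≤ (n / √(m : ℝ)) * (124 * (depth n : ℝ) ^ 3 * (769 * (depth n : ℝ) ^ 2 * (1 / ε) ^ 2)) := by
        have := oversampling_le h0 h1 n
        gcongr
    _ = (n / √(m : ℝ)) * (124 * 769 * ((depth n : ℝ) ^ 5 * (1 / ε) ^ 2)) := by ring
    _ ≤ (n / √(m : ℝ)) * (124 * 769 * ((3 * Real.log n) ^ 5 * (1 / ε) ^ 5)) := by
        have : 0 ≤ (3 * Real.log n) ^ 5 := le_trans (by positivity) hL5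
        gcongr
    _ = _ := by ring

end QueryAlg

theorem theorem3p1 :
    ∃ (EstimateEdges : ℝ → (n : ℕ) → QueryAlg n ℝ) (C : ℝ) (c : ℕ) (δ : ℕ → ℝ),
      Filter.Tendsto δ Filter.atTop (nhds 0) ∧
      ∀ (ε : ℝ), 0 < ε → ε < 1 →
      ∀ (n : ℕ) (G : SimpleGraph (Fin n)) (m : ℕ), m = G.edgeSet.ncard → 1 ≤ m →
        ENNReal.ofReal (1 - δ n) ≤
          ((EstimateEdges ε n).run (indepSetOracle G)).toOuterMeasure
            {r : ℝ × ℕ |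
              (r.2 : ℝ) ≤ ((n : ℝ) / √(m : ℝ)) * (C * Real.log (n : ℝ) ^ c * (1 / ε) ^ c) ∧
              (1 - ε) * (m : ℝ) ≤ r.1 ∧ r.1 ≤ (1 + ε) * (m : ℝ)} := by
  classical
  refine ⟨QueryAlg.estimateEdges, 124 * 769 * 243, 5, fun n => 2 / QueryAlg.depth n,
    QueryAlg.tendsto_two_div_depth, ?_⟩
  intro ε h0 h1 n G m hm hm1
  have hmn : 2 * m ≤ n ^ 2 := by
    rw [hm, ← G.card_dartsIn_univ]
    refine (Finset.card_filter_le _ _).trans (le_of_eq ?_)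
    simp [sq]
  have hn : 2 ≤ n := by nlinarith
  have hq : n ^ 2 / m ≠ 0 := (Nat.div_pos (by omega) hm1).ne'
  have hT : m * 4 ^ Nat.log 4 (n ^ 2 / m) ≤ n ^ 2 :=
    (Nat.mul_le_mul_left m (Nat.pow_log_le_self 4 hq)).trans (Nat.mul_div_le _ _)
  have hT' : n ^ 2 < m * 4 ^ (Nat.log 4 (n ^ 2 / m) + 1) :=
    mul_comm m _ ▸ (Nat.div_lt_iff_lt_mul hm1).1 (Nat.lt_pow_succ_log_self (by norm_num) _)
  have hbad := QueryAlg.expect_estimateEdges_le h0 h1 G hm hm1 hT hT'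
  have hbound := QueryAlg.queryBound_le h0 h1 hn hm1 hT
  rw [QueryAlg.toOuterMeasure_run]
  refine ENNReal.ofReal_le_ofReal ?_
  rw [sub_le_iff_le_add]
  refine le_trans ?_ (add_le_add_right hbad _)
  rw [← QueryAlg.expect_add]
  refine (QueryAlg.expect_const (O := indepSetOracle G)
    (QueryAlg.estimateEdges ε n) 1).symm.le.trans ?_
  refine QueryAlg.expect_mono _ fun r => ?_
  split_ifs with h
  · rw [Set.indicator_of_mem]
    · simp
    · exact ⟨by simpa using h.1.trans hbound, h.2⟩
  · have := Set.indicator_nonneg (s := {r : ℝ × ℕ |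
      (r.2 : ℝ) ≤ ((n : ℝ) / √(m : ℝ)) *
        (124 * 769 * 243 * Real.log (n : ℝ) ^ 5 * (1 / ε) ^ 5) ∧
      (1 - ε) * (m : ℝ) ≤ r.1 ∧ r.1 ≤ (1 + ε) * (m : ℝ)}) (f := fun _ => (1 : ℝ))
      (fun _ _ => zero_le_one) r
    linarith
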